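/- Fix finitely many customer types $1,\dots,k$, where type $n$ has show-up probability $p_n\in(0,1]$ and revenue $v_n\in\mathbb{R}$ with critical ratio $q_n=v_n/p_n<1$. For $x\in\mathbb{N}^k$ let $X_{n,x_n}\sim\mathrm{Bin}(x_n,p_n)$, $n=1,\dots,k$, be independent. Given a capacity $B\in\mathbb{N}$, a vector of future arrivals $N\in\mathbb{N}^k$ and a vector of past acceptances $y\in\mathbb{N}^k$, a vector $x^\star\in\mathbb{N}^k$ is a feasible solution if $x^\star_n\le N_n$ for all $n$. A feasible solution $x^\star$ is called locally optimal at $j$ if $x^\star_j$ is the largest maximizer, over integers $0\le a\le N_j$, of $$a\,v_j-\mathbb{E}\Big[\Big(X_{j,y_j+a}+\sum_{n\ne j}X_{n,y_n+x^\star_n}-B\Big)^+\Big].$$ There is an integer constant $\delta\ge 1$, depending only on $k$, $(p_n)$ and $(v_n)$ (in particular not on $B$, $N$, $y$, $x^\star$, $i$, $j$), with the following properties for all $B$, $N$, $y$ and all types $i,j$. Here $e_n$ denotes the $n$-th unit vector. (a) If $x^\star$ is locally optimal at $j$, and $x^\star_i<N_i$ in case $i\neq j$, then there is $l\in\{0,1,\dots,\delta\}$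 such that $x'=x^\star+e_i-l\,e_j$ is a (nonnegative, feasible) solution that is locally optimal at $j$. (b) Consequently, the locally optimal number of type-$j$ acceptances is Lipschitz in the count of another type: if $x$ and $x'$ are both locally optimal at $j$ and $x_n=x'_n$ for all $n\notin\{i,j\}$, then $|x_j-x'_j|\le\delta\,|x_i-x'_i|$. -/

import Mathlib

open MeasureTheory ProbabilityTheory
open scoped unitInterval

noncomputable section

namespace Overbooking

/-- The joint law of the independent counts `X_{n, x_n} ∼ Bin(x_n, p_n)`, where `X_{n, x_n}` is the
number of customers, among the `x n` accepted customers of type `n`, who consume a resource. -/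
def showUpLaw {k : ℕ} (p : Fin k → I) (x : Fin k → ℕ) : Measure (Fin k → ℕ) :=
  Measure.pi fun n => binomial (x n) (p n)

/-- The expected compensation `E[(∑ n, X_{n, x_n} - B)⁺]` for capacity `B` when `x n` customers of
each type `n` have been accepted in total. -/
def expectedCompensation {k : ℕ} (p : Fin k → I) (B : ℕ) (x : Fin k → ℕ) : ℝ :=
  ∫ c, max ((∑ n, (c n : ℝ)) - (B : ℝ)) 0 ∂(showUpLaw p x)

/-- The objective of the one-dimensional problem at type `j`: with past acceptances `past` and with
`x n` future acceptances of each type `n ≠ j`, the revenue from `a` future acceptances of type `j`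
minus the expected compensation. -/
def localObjective {k : ℕ} (p : Fin k → I) (v : Fin k → ℝ) (B : ℕ) (past x : Fin k → ℕ)
    (j : Fin k) (a : ℕ) : ℝ :=
  (a : ℝ) * v j - expectedCompensation p B (past + Function.update x j a)

/-- `x` is a feasible solution for the future arrivals `N`: at most `N n` future customers of each
type `n` are accepted. -/
def Feasible {k : ℕ} (N x : Fin k → ℕ) : Prop :=
  ∀ n, x n ≤ N n

/-- The set of maximizers of the local objective at `j` over `0 ≤ a ≤ N j`. -/
def localArgmax {k : ℕ} (p : Fin k → I) (v : Fin k → ℝ) (B : ℕ) (N past x : Fin k → ℕ)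
    (j : Fin k) : Set ℕ :=
  {a | a ≤ N j ∧ ∀ b, b ≤ N j →
    localObjective p v B past x j b ≤ localObjective p v B past x j a}

/-- The feasible solution `x` is locally optimal at `j`: its entry `x j` is the largest maximizer of
the local objective at `j`. -/
def LocallyOptimal {k : ℕ} (p : Fin k → I) (v : Fin k → ℝ) (B : ℕ) (N past x : Fin k → ℕ)
    (j : Fin k) : Prop :=
  Feasible N x ∧ IsGreatest (localArgmax p v B N past x j) (x j)

end Overbooking

end

/-!
Write `S` for the number of show-ups among all accepted customers. One more acceptance of type `j`
changes the objective by `v j - p j * P(S ≥ B)` (`localObjective_succ`), which decreases in the number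
of acceptances, so the locally optimal entry is the first one at which `P(S ≥ B) > q j = v j / p j`,
capped at `N j`.

An additional customer of type `i` raises `P(S ≥ B)`, but not above `P(S ≥ B - 1)`. Hence the locally
optimal entry does not increase, and it drops by at most `d` as soon as
`P(S + T ≥ B) ≤ q j` implies `P(S ≥ B - 1) ≤ q j`, where `T` is binomial with parameters `d` and `p j`.
A number `d` with this property for all `S` and `B` exists because `q j < 1`
(`exists_showUpTail_sub_one_le`). Going from `P(S ≥ B - 1)` to `P(S + T ≥ B)` loses
`P(T = 0) P(S = B - 1)` and gains at least `P(T ≥ 2) P(S = B - 2)`. Since `P(T = 0)` is tiny, the gain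
prevails unless `P(S = B - 2)` is much smaller than `P(S = B - 1)`. In that case the log-concavity of
the distribution function of `S` (`showUpTail_logConcave`) makes `P(S < B - 1)` small, and
`P(S + T ≥ B)` is close to `1`, hence above `q j`.

Iterating over single acceptances of type `i` gives the Lipschitz estimate.
-/

namespace Overbooking

variable {k : ℕ}

/-! ### One more accepted customer -/

theorem binomial_succ_real_singleton_zero (n : ℕ) (p : I) :
    (binomial (n + 1) p).real {0} = (1 - (p : ℝ)) * (binomial n p).real {0} := by
  simp only [binomial_real_zero]
  ring

theorem binomial_succ_real_singleton_succ (n m : ℕ) (p : I) :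
    (binomial (n + 1) p).real {m + 1} =
      p * (binomial n p).real {m} + (1 - (p : ℝ)) * (binomial n p).real {m + 1} := by
  simp only [binomial_real_singleton, Nat.choose_succ_succ, Nat.add_sub_add_right]
  rcases lt_or_ge m n with h | h
  · obtain ⟨t, rfl⟩ := Nat.exists_eq_add_of_lt h
    have h1 : m + t + 1 - m = t + 1 := by omega
    have h2 : m + t + 1 - (m + 1) = t := by omega
    rw [h1, h2]
    push_cast
    ring
  · rw [Nat.choose_eq_zero_of_lt (show n < m + 1 by omega)]
    push_cast
    ring

instance (p : Fin k → I) (x : Fin k → ℕ) : IsProbabilityMeasure (showUpLaw p x) := by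
  unfold showUpLaw
  infer_instance

theorem showUpLaw_real_singleton (p : Fin k → I) (x c : Fin k → ℕ) :
    (showUpLaw p x).real {c} = ∏ n, (binomial (x n) (p n)).real {c n} := by
  simp [showUpLaw, measureReal_def, Measure.pi_singleton, ENNReal.toReal_prod]

/-- One more accepted customer of type `j` shows up with probability `p j`, independently of all
the others. -/
theorem showUpLaw_add_single (p : Fin k → I) (x : Fin k → ℕ) (j : Fin k) :
    showUpLaw p (x + Pi.single j 1) =
      unitInterval.toNNReal (p j) • (showUpLaw p x).map (fun c => c + Pi.single j 1) +
        unitInterval.toNNReal (unitInterval.symm (p j)) • showUpLaw p x := by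
  refine Measure.ext_of_measureReal_singleton fun c => ?_
  have hmap : ((showUpLaw p x).map (fun c => c + Pi.single j 1)).real {c} =
      (showUpLaw p x).real ((fun c => c + Pi.single j 1) ⁻¹' {c}) :=
    map_measureReal_apply .of_discrete (measurableSet_singleton c)
  rw [measureReal_add_apply, measureReal_nnreal_smul_apply, measureReal_nnreal_smul_apply, hmap,
    showUpLaw_real_singleton, showUpLaw_real_singleton,
    ← Finset.mul_prod_erase _ _ (Finset.mem_univ j), ← Finset.mul_prod_erase _ _ (Finset.mem_univ j)]
  have hrest : ∏ n ∈ Finset.univ.erase j,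
      (binomial ((x + Pi.single j 1 : Fin k → ℕ) n) (p n)).real {c n} =
      ∏ n ∈ Finset.univ.erase j, (binomial (x n) (p n)).real {c n} := by
    refine Finset.prod_congr rfl fun n hn => ?_
    simp [Finset.ne_of_mem_erase hn]
  rw [hrest]
  simp only [Pi.add_apply, Pi.single_eq_same]
  rcases hc : c j with _ | m
  · have hpre : (fun c : Fin k → ℕ => c + Pi.single j 1) ⁻¹' {c} = ∅ := by
      ext d
      simp only [Set.mem_preimage, Set.mem_singleton_iff, Set.mem_empty_iff_false, iff_false]
      intro h
      have := congrFun h j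
      simp [hc] at this
    rw [hpre, binomial_succ_real_singleton_zero]
    simp
    ring
  · have hpre : (fun c : Fin k → ℕ => c + Pi.single j 1) ⁻¹' {c} = {Function.update c j m} := by
      ext d
      simp only [Set.mem_preimage, Set.mem_singleton_iff]
      constructor
      · rintro rfl
        ext n
        by_cases hn : n = j
        · subst hn
          simpa using hc
        · simp [hn]
      · rintro rfl
        ext n
        by_cases hn : n = j
        · subst hn
          simp [hc]
        · simp [hn]
    have hrest' : ∏ n ∈ Finset.univ.erase j,
        (binomial (x n) (p n)).real {Function.update c j m n} =
        ∏ n ∈ Finset.univ.erase j, (binomial (x n) (p n)).real {c n} := by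
      refine Finset.prod_congr rfl fun n hn => ?_
      simp [Finset.ne_of_mem_erase hn]
    rw [hpre, showUpLaw_real_singleton, ← Finset.mul_prod_erase _ _ (Finset.mem_univ j), hrest',
      binomial_succ_real_singleton_succ]
    simp
    ring

theorem showUpLaw_zero (p : Fin k → I) : showUpLaw p 0 = Measure.dirac 0 := by
  refine Measure.ext_of_measureReal_singleton fun c => ?_
  rw [showUpLaw_real_singleton]
  simp only [Pi.zero_apply, binomial_zero]
  by_cases h : c = 0
  · subst h
    simp [measureReal_def]
  · obtain ⟨n, hn⟩ := Function.ne_iff.1 h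
    rw [Finset.prod_eq_zero (Finset.mem_univ n)]
    · simp [measureReal_def, Ne.symm h]
    · have : (0 : ℕ) ∉ ({c n} : Set ℕ) := fun h => hn h.symm
      rw [measureReal_def, Measure.dirac_apply' _ (measurableSet_singleton _)]
      simp [this]

/-- Induction on acceptance vectors, one customer at a time. -/
theorem induction_add_single {P : (Fin k → ℕ) → Prop} (zero : P 0)
    (add_single : ∀ x j, P x → P (x + Pi.single j 1)) (x : Fin k → ℕ) : P x := by
  induction hs : ∑ n, x n generalizing x with
  | zero =>
    have : x = 0 := by
      ext n
      exact Finset.sum_eq_zero_iff.1 hs n (Finset.mem_univ n)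
    exact this ▸ zero
  | succ s ih =>
    obtain ⟨j, -, hj⟩ : ∃ j ∈ Finset.univ, x j ≠ 0 :=
      Finset.exists_ne_zero_of_sum_ne_zero (by omega)
    have hx : x = (x - Pi.single j 1) + Pi.single j 1 := by
      ext n
      by_cases hn : n = j
      · subst hn
        simp
        omega
      · simp [hn]
    rw [hx]
    refine add_single _ _ (ih _ ?_)
    rw [hx] at hs
    simpa [Finset.sum_add_distrib] using hs

theorem integrable_showUpLaw (p : Fin k → I) (x : Fin k → ℕ) (g : (Fin k → ℕ) → ℝ) :
    Integrable g (showUpLaw p x) := by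
  induction x using induction_add_single generalizing g with
  | zero =>
    rw [showUpLaw_zero]
    exact integrable_dirac (by simp)
  | add_single x j ih =>
    rw [showUpLaw_add_single]
    refine (Integrable.smul_measure_nnreal ?_).add_measure (ih g).smul_measure_nnreal
    rw [integrable_map_measure Measurable.of_discrete.aestronglyMeasurable .of_discrete]
    exact ih _

theorem integral_showUpLaw_add_single (p : Fin k → I) (x : Fin k → ℕ) (j : Fin k)
    (g : (Fin k → ℕ) → ℝ) :
    ∫ c, g c ∂showUpLaw p (x + Pi.single j 1) =
      p j * ∫ c, g (c + Pi.single j 1) ∂showUpLaw p x +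
        (1 - (p j : ℝ)) * ∫ c, g c ∂showUpLaw p x := by
  have hmap : Integrable g ((showUpLaw p x).map (fun c => c + Pi.single j 1)) := by
    rw [integrable_map_measure Measurable.of_discrete.aestronglyMeasurable .of_discrete]
    exact integrable_showUpLaw p x _
  rw [showUpLaw_add_single, integral_add_measure hmap.smul_measure_nnreal
    (integrable_showUpLaw p x g).smul_measure_nnreal, integral_smul_nnreal_measure,
    integral_smul_nnreal_measure, integral_map .of_discrete hmap.aestronglyMeasurable]
  simp [NNReal.smul_def]

/-! ### Tail probabilities and log-concavity -/

/-- The probability that at least `m` of the accepted customers `x` show up. The threshold is an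
integer so that lowering it by one is always meaningful. -/
noncomputable def showUpTail (p : Fin k → I) (x : Fin k → ℕ) (m : ℤ) : ℝ :=
  ∫ c, (if m ≤ ∑ n, (c n : ℤ) then 1 else 0) ∂showUpLaw p x

theorem sum_add_single (c : Fin k → ℕ) (j : Fin k) :
    ∑ n, (((c + Pi.single j 1 : Fin k → ℕ) n : ℕ) : ℤ) = ∑ n, (c n : ℤ) + 1 := by
  have : ∑ n, (c + Pi.single j 1 : Fin k → ℕ) n = ∑ n, c n + 1 := by
    simp [Finset.sum_add_distrib]
  exact_mod_cast this

theorem showUpTail_zero (p : Fin k → I) (m : ℤ) :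
    showUpTail p 0 m = if m ≤ 0 then 1 else 0 := by
  simp [showUpTail, showUpLaw_zero]

theorem showUpTail_add_single (p : Fin k → I) (x : Fin k → ℕ) (j : Fin k) (m : ℤ) :
    showUpTail p (x + Pi.single j 1) m =
      p j * showUpTail p x (m - 1) + (1 - (p j : ℝ)) * showUpTail p x m := by
  simp only [showUpTail, integral_showUpLaw_add_single, sum_add_single, sub_le_iff_le_add]

theorem showUpTail_antitone (p : Fin k → I) (x : Fin k → ℕ) : Antitone (showUpTail p x) := by
  intro m m' h
  refine integral_mono (integrable_showUpLaw p x _) (integrable_showUpLaw p x _) fun c => ?_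
  dsimp only
  split_ifs with h1 h2
  · exact le_rfl
  · exact absurd (h.trans h1) h2
  · exact zero_le_one
  · exact le_rfl

theorem showUpTail_nonneg (p : Fin k → I) (x : Fin k → ℕ) (m : ℤ) : 0 ≤ showUpTail p x m :=
  integral_nonneg fun c => by dsimp only; split_ifs <;> simp

theorem showUpTail_le_one (p : Fin k → I) (x : Fin k → ℕ) (m : ℤ) : showUpTail p x m ≤ 1 := by
  have : showUpTail p x m ≤ ∫ _, (1 : ℝ) ∂showUpLaw p x :=
    integral_mono (integrable_showUpLaw p x _) (integrable_showUpLaw p x _) fun c => by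
      dsimp only; split_ifs <;> simp
  simpa using this

theorem showUpTail_le_add_single (p : Fin k → I) (x : Fin k → ℕ) (j : Fin k) (m : ℤ) :
    showUpTail p x m ≤ showUpTail p (x + Pi.single j 1) m := by
  rw [showUpTail_add_single]
  have := showUpTail_antitone p x (sub_one_lt m).le
  nlinarith [(p j).2.1]

theorem showUpTail_add_single_le (p : Fin k → I) (x : Fin k → ℕ) (j : Fin k) (m : ℤ) :
    showUpTail p (x + Pi.single j 1) m ≤ showUpTail p x (m - 1) := by
  rw [showUpTail_add_single]
  have := showUpTail_antitone p x (sub_one_lt m).le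
  nlinarith [(p j).2.2]

theorem showUpTail_monotone_nsmul (p : Fin k → I) (x : Fin k → ℕ) (j : Fin k) (m : ℤ) :
    Monotone fun d : ℕ => showUpTail p (x + d • Pi.single j 1) m := by
  refine monotone_nat_of_le_succ fun d => ?_
  rw [succ_nsmul, ← add_assoc]
  exact showUpTail_le_add_single p _ j m

/-- The distribution function of the number of customers who show up is log-concave. The inequality
is stated for a pair `a ≤ b`, a form that passes to the convolution with a Bernoulli law. -/
theorem showUpTail_logConcave (p : Fin k → I) (x : Fin k → ℕ) {a b : ℤ} (hab : a ≤ b) :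
    (1 - showUpTail p x (a - 1)) * (1 - showUpTail p x (b + 1)) ≤
      (1 - showUpTail p x a) * (1 - showUpTail p x b) := by
  induction x using induction_add_single generalizing a b with
  | zero =>
    simp only [showUpTail_zero]
    split_ifs <;> first | omega | norm_num
  | add_single x j ih =>
    simp only [showUpTail_add_single]
    have h1 := ih hab
    have h2 := ih (show a - 1 ≤ b - 1 by omega)
    have e : b + 1 - 1 = b := by ring
    have e' : b - 1 + 1 = b := by ring
    rw [e'] at h2
    rw [e]
    -- The mixed term: the inequality for `a - 1 ≤ b` followed by the one for `a ≤ b - 1`, the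
    -- latter being an identity when `a = b`.
    have h3 : (1 - showUpTail p x (a - 1 - 1)) * (1 - showUpTail p x (b + 1)) ≤
        (1 - showUpTail p x a) * (1 - showUpTail p x (b - 1)) := by
      refine (ih (show a - 1 ≤ b by omega)).trans ?_
      rcases hab.eq_or_lt with rfl | h
      · rw [mul_comm]
      · have := ih (show a ≤ b - 1 by omega)
        rwa [e'] at this
    have hp := (p j).2.1
    have hr : 0 ≤ 1 - (p j : ℝ) := sub_nonneg.2 (p j).2.2
    have k1 := mul_le_mul_of_nonneg_left h1 (mul_nonneg hr hr)
    have k2 := mul_le_mul_of_nonneg_left h2 (mul_nonneg hp hp)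
    have k3 := mul_le_mul_of_nonneg_left h3 (mul_nonneg hp hr)
    linarith

/-- At least one of `d` additional customers of type `j` shows up with probability
`1 - (1 - p j) ^ d`. -/
theorem showUpTail_nsmul_ge (p : Fin k → I) (x : Fin k → ℕ) (j : Fin k) (m : ℤ) (d : ℕ) :
    (1 - (1 - (p j : ℝ)) ^ d) * showUpTail p x (m - 1) + (1 - (p j : ℝ)) ^ d * showUpTail p x m ≤
      showUpTail p (x + d • Pi.single j 1) m := by
  induction d with
  | zero => simp
  | succ d ih =>
    rw [succ_nsmul, ← add_assoc, showUpTail_add_single]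
    have h0 : showUpTail p x (m - 1) ≤ showUpTail p (x + d • Pi.single j 1) (m - 1) := by
      simpa using showUpTail_monotone_nsmul p x j (m - 1) d.zero_le
    have k1 := mul_le_mul_of_nonneg_left h0 (p j).2.1
    have k2 := mul_le_mul_of_nonneg_left ih (sub_nonneg.2 (p j).2.2)
    rw [pow_succ]
    linarith

/-- A refinement of `showUpTail_nsmul_ge` that also counts the event that at least two of the
additional customers show up, of probability at least `p j ^ 2`. -/
theorem showUpTail_nsmul_ge_of_two_le (p : Fin k → I) (x : Fin k → ℕ) (j : Fin k) (m : ℤ) {d : ℕ}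
    (hd : 2 ≤ d) :
    (1 - (1 - (p j : ℝ)) ^ d) * showUpTail p x (m - 1) + (1 - (p j : ℝ)) ^ d * showUpTail p x m +
        (p j : ℝ) ^ 2 * (showUpTail p x (m - 2) - showUpTail p x (m - 1)) ≤
      showUpTail p (x + d • Pi.single j 1) m := by
  induction d, hd using Nat.le_induction with
  | base =>
    rw [two_nsmul, ← add_assoc]
    simp only [showUpTail_add_single]
    rw [show m - 1 - 1 = m - 2 by ring]
    linarith
  | succ d hd ih =>
    rw [succ_nsmul, ← add_assoc, showUpTail_add_single]
    have hp := (p j).2.1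
    have hr : 0 ≤ 1 - (p j : ℝ) := sub_nonneg.2 (p j).2.2
    have hf : 0 ≤ showUpTail p x (m - 2) - showUpTail p x (m - 1) :=
      sub_nonneg.2 (showUpTail_antitone p x (by omega))
    have h0 : showUpTail p (x + 1 • Pi.single j 1) (m - 1) ≤
        showUpTail p (x + d • Pi.single j 1) (m - 1) :=
      showUpTail_monotone_nsmul p x j (m - 1) (show 1 ≤ d by omega)
    rw [one_nsmul, showUpTail_add_single, show m - 1 - 1 = m - 2 by ring] at h0
    have k1 := mul_le_mul_of_nonneg_left h0 hp
    have k2 := mul_le_mul_of_nonneg_left ih hr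
    have k3 : 0 ≤ (1 - (p j : ℝ)) * (p j : ℝ) ^ 2 * (showUpTail p x (m - 2) - showUpTail p x (m - 1)) :=
      mul_nonneg (mul_nonneg hr (sq_nonneg _)) hf
    rw [pow_succ (1 - (p j : ℝ)) d]
    linarith

/-- If the increments of a log-concave distribution function drop by a factor below `ε / 2` from
`c - b` to `b - a`, then at most `ε` of the mass lies below the larger increment. -/
theorem le_of_mul_sub_lt_of_mul_le_sq {ε a b c : ℝ} (hε0 : 0 < ε) (hε1 : ε ≤ 1) (ha : 0 ≤ a)
    (hab : a ≤ b) (hbc : b ≤ c) (hc : c ≤ 1) (hlc : a * c ≤ b ^ 2)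
    (h : 2 * (b - a) < ε * (c - b)) : b ≤ ε := by
  by_contra! hb
  have h1 : a * (c - b) ≤ b * (b - a) := by linarith
  rcases hab.eq_or_lt with rfl | hlt
  · have : 0 < a * (c - a) := mul_pos (by linarith) (by nlinarith)
    linarith
  · have h2 : 2 * a * (b - a) ≤ ε * b * (b - a) := by
      have k1 := mul_le_mul_of_nonneg_left h1 hε0.le
      have k2 := mul_le_mul_of_nonneg_left h.le ha
      linarith
    have h3 : 2 * a ≤ ε * b := le_of_mul_le_mul_right h2 (by linarith)
    have h4 : ε * b ≤ b := mul_le_of_le_one_left (by linarith) hε1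
    have h5 : ε * (c - b) ≤ ε := mul_le_of_le_one_right hε0.le (by linarith)
    linarith

/-- If sufficiently many additional customers of type `j` keep a tail probability at most `q < 1`,
then so does a single additional customer who shows up for certain, uniformly in the other customers
and in the threshold. For a given `ε`, either the mass at `m - 1` is at most `2 / ε` times that at `m - 2`,
and the gain from two or more show-ups outweighs the loss from none; or log-concavity leaves
probability at most `ε` below `m - 1`, and a single show-up gives a tail probability above `q`. -/
theorem exists_showUpTail_sub_one_le (p : Fin k → I) {j : Fin k} (hp : (0 : ℝ) < p j) {q : ℝ}
    (hq : q < 1) :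
    ∃ d : ℕ, ∀ (x : Fin k → ℕ) (m : ℤ),
      showUpTail p (x + d • Pi.single j 1) m ≤ q → showUpTail p x (m - 1) ≤ q := by
  obtain ⟨ε, hε0, hε1, hεq⟩ : ∃ ε : ℝ, 0 < ε ∧ ε ≤ 1 ∧ q < (1 - ε) * (1 - ε) := by
    refine ⟨(1 - max q 0) / 2, ?_, ?_, ?_⟩
    · have : max q 0 < 1 := max_lt hq one_pos
      linarith
    · linarith [le_max_right q 0]
    · have : max q 0 < 1 := max_lt hq one_pos
      nlinarith [le_max_left q 0]
  have hr0 : 0 ≤ 1 - (p j : ℝ) := sub_nonneg.2 (p j).2.2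
  obtain ⟨d, hd2, hd⟩ : ∃ d : ℕ, 2 ≤ d ∧ (1 - (p j : ℝ)) ^ d < min ε ((p j : ℝ) ^ 2 * ε / 2) := by
    obtain ⟨d, hd⟩ := exists_pow_lt_of_lt_one
      (show 0 < min ε ((p j : ℝ) ^ 2 * ε / 2) by positivity) (show 1 - (p j : ℝ) < 1 by linarith)
    exact ⟨d + 2, by omega,
      (pow_le_pow_of_le_one hr0 (by linarith) (by omega)).trans_lt hd⟩
  have hdε := hd.trans_le (min_le_left _ _)
  have hdp := hd.trans_le (min_le_right _ _)
  refine ⟨d, fun x m hm => ?_⟩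
  have hanti := showUpTail_antitone p x
  have hG0 : showUpTail p x m ≤ showUpTail p x (m - 1) := hanti (by omega)
  have hG1 : showUpTail p x (m - 1) ≤ showUpTail p x (m - 2) := hanti (by omega)
  rcases le_or_gt (ε * (showUpTail p x (m - 1) - showUpTail p x m))
    (2 * (showUpTail p x (m - 2) - showUpTail p x (m - 1))) with h | h
  · refine le_trans ?_ hm
    refine le_trans ?_ (showUpTail_nsmul_ge_of_two_le p x j m hd2)
    have k1 := mul_le_mul_of_nonneg_right hdp.le (sub_nonneg.2 hG0)
    have k2 := mul_le_mul_of_nonneg_left h (sq_nonneg (p j : ℝ))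
    linarith
  · exfalso
    have hlc := showUpTail_logConcave p x (le_refl (m - 1))
    rw [show m - 1 - 1 = m - 2 by ring, sub_add_cancel, ← sq] at hlc
    have hb := le_of_mul_sub_lt_of_mul_le_sq hε0 hε1
      (sub_nonneg.2 (showUpTail_le_one p x (m - 2))) (sub_le_sub_left hG1 1)
      (sub_le_sub_left hG0 1) (sub_le_self 1 (showUpTail_nonneg p x m)) hlc (by linarith)
    have h1 := showUpTail_nsmul_ge p x j m d
    have h2 : 0 ≤ (1 - (p j : ℝ)) ^ d * showUpTail p x m :=
      mul_nonneg (pow_nonneg hr0 d) (showUpTail_nonneg p x m)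
    have h3 : (1 - ε) * (1 - ε) ≤
        (1 - (1 - (p j : ℝ)) ^ d) * showUpTail p x (m - 1) :=
      mul_le_mul (by linarith) (by linarith) (by linarith) (by linarith)
    linarith

/-! ### Marginal revenue and locally optimal solutions -/

theorem expectedCompensation_add_single (p : Fin k → I) (B : ℕ) (x : Fin k → ℕ) (j : Fin k) :
    expectedCompensation p B (x + Pi.single j 1) =
      expectedCompensation p B x + p j * showUpTail p x B := by
  have hkey : showUpTail p x B =
      ∫ c, max ((∑ n, (((c + Pi.single j 1 : Fin k → ℕ) n : ℕ) : ℝ)) - (B : ℝ)) 0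
        ∂showUpLaw p x - expectedCompensation p B x := by
    unfold showUpTail expectedCompensation
    rw [← integral_sub (integrable_showUpLaw p x _) (integrable_showUpLaw p x _)]
    refine integral_congr_ae (.of_forall fun c => ?_)
    have hsum : ∑ n, (((c + Pi.single j 1 : Fin k → ℕ) n : ℕ) : ℝ) = ∑ n, (c n : ℝ) + 1 := by
      exact_mod_cast sum_add_single c j
    dsimp only
    rw [hsum]
    split_ifs with h
    · have h' : (B : ℝ) ≤ ∑ n, (c n : ℝ) := by exact_mod_cast h
      rw [max_eq_left (by linarith), max_eq_left (by linarith)]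
      ring
    · have h' : (∑ n, (c n : ℝ)) + 1 ≤ B := by exact_mod_cast not_le.1 h
      rw [max_eq_right (by linarith), max_eq_right (by linarith)]
      ring
  rw [hkey, expectedCompensation, integral_showUpLaw_add_single, expectedCompensation]
  ring

theorem add_update_add (past x : Fin k → ℕ) (j : Fin k) (a d : ℕ) :
    past + Function.update x j (a + d) =
      past + Function.update x j a + d • Pi.single j 1 := by
  ext n
  by_cases hn : n = j
  · subst hn
    simp [add_assoc]
  · simp [hn]

theorem add_update_add_single (past x : Fin k → ℕ) {i j : Fin k} (hij : i ≠ j) (a : ℕ) :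
    past + Function.update (x + Pi.single i 1) j a =
      past + Function.update x j a + Pi.single i 1 := by
  ext n
  by_cases hn : n = j
  · subst hn
    simp [hij.symm]
  · simp [hn, add_assoc]

/-- The marginal revenue of one more acceptance of type `j`: the newcomer costs a unit of
compensation exactly when showing up to find the capacity exhausted. -/
theorem localObjective_succ (p : Fin k → I) (v : Fin k → ℝ) (B : ℕ) (past x : Fin k → ℕ)
    (j : Fin k) (a : ℕ) :
    localObjective p v B past x j (a + 1) = localObjective p v B past x j a +
      (v j - p j * showUpTail p (past + Function.update x j a) B) := by
  unfold localObjective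
  rw [add_update_add, one_nsmul, expectedCompensation_add_single]
  push_cast
  ring

theorem localArgmax_congr (p : Fin k → I) (v : Fin k → ℝ) (B : ℕ) (N past : Fin k → ℕ)
    {x y : Fin k → ℕ} {j : Fin k} (h : ∀ n, n ≠ j → x n = y n) :
    localArgmax p v B N past x j = localArgmax p v B N past y j := by
  have hu : ∀ a, Function.update x j a = Function.update y j a := by
    intro a
    ext n
    by_cases hn : n = j
    · subst hn
      simp
    · simp [hn, h n hn]
  simp only [localArgmax, localObjective, hu]

theorem LocallyOptimal.eq_of_eq_off {p : Fin k → I} {v : Fin k → ℝ} {B : ℕ}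
    {N past x y : Fin k → ℕ} {j : Fin k} (hx : LocallyOptimal p v B N past x j)
    (hy : LocallyOptimal p v B N past y j) (h : ∀ n, n ≠ j → x n = y n) : x = y := by
  ext n
  by_cases hn : n = j
  · subst hn
    have hx' := hx.2
    rw [localArgmax_congr p v B N past h] at hx'
    exact hx'.unique hy.2
  · exact h n hn

theorem exists_isGreatest_localArgmax (p : Fin k → I) (v : Fin k → ℝ) (B : ℕ)
    (N past x : Fin k → ℕ) (j : Fin k) : ∃ a, IsGreatest (localArgmax p v B N past x j) a := by
  have hne : (localArgmax p v B N past x j).Nonempty := by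
    obtain ⟨a, ha, hmax⟩ := (Finset.range (N j + 1)).exists_max_image
      (localObjective p v B past x j) ⟨0, by simp⟩
    exact ⟨a, by simpa [Nat.lt_succ_iff] using ha, fun b hb => hmax b (by simpa using by omega)⟩
  have hbdd : BddAbove (localArgmax p v B N past x j) := ⟨N j, fun a ha => ha.1⟩
  exact ⟨_, Nat.sSup_mem hne hbdd, fun a ha => le_csSup hbdd ha⟩

/-- The marginal revenue at the largest maximizer is negative, unless the bound `N j` is attained. -/
theorem lt_mul_showUpTail_of_isGreatest {p : Fin k → I} {v : Fin k → ℝ} {B : ℕ}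
    {N past x : Fin k → ℕ} {j : Fin k} {X : ℕ}
    (h : IsGreatest (localArgmax p v B N past x j) X) (hX : X < N j) :
    v j < p j * showUpTail p (past + Function.update x j X) B := by
  by_contra! hle
  have hs := localObjective_succ p v B past x j X
  have : X + 1 ∈ localArgmax p v B N past x j :=
    ⟨hX, fun b hb => (h.1.2 b hb).trans (by linarith)⟩
  have := h.2 this
  omega

/-- The marginal revenue is nonnegative everywhere below a maximizer, because the objective is
concave. -/
theorem mul_showUpTail_le_of_isGreatest {p : Fin k → I} {v : Fin k → ℝ} {B : ℕ}
    {N past x : Fin k → ℕ} {j : Fin k} {X : ℕ}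
    (h : IsGreatest (localArgmax p v B N past x j) X) {a : ℕ} (ha : a < X) :
    p j * showUpTail p (past + Function.update x j a) B ≤ v j := by
  by_contra! hlt
  have hstep : ∀ d : ℕ, localObjective p v B past x j (a + d + 1) <
      localObjective p v B past x j (a + d) := by
    intro d
    have hm : p j * showUpTail p (past + Function.update x j a) B ≤
        p j * showUpTail p (past + Function.update x j (a + d)) B := by
      rw [add_update_add]
      refine mul_le_mul_of_nonneg_left ?_ (p j).2.1
      simpa using showUpTail_monotone_nsmul p (past + Function.update x j a) j B d.zero_le
    have hs := localObjective_succ p v B past x j (a + d)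
    linarith
  have hdec := strictAnti_nat_of_succ_lt (f := fun d => localObjective p v B past x j (a + d)) hstep
  obtain ⟨d, rfl⟩ := Nat.exists_eq_add_of_lt ha
  exact (hdec d.succ_pos).not_ge (h.1.2 a (ha.le.trans h.1.1))

/-- If `d` further customers of type `j` outweigh one who shows up for certain, then one more
acceptance of type `i` lowers the locally optimal number of type-`j` acceptances by at most `d`. -/
theorem LocallyOptimal.exists_add_single {p : Fin k → I} {v : Fin k → ℝ} {B : ℕ}
    {N past x : Fin k → ℕ} {i j : Fin k} (hp : (0 : ℝ) < p j) {d : ℕ}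
    (hd : ∀ (z : Fin k → ℕ) (m : ℤ), showUpTail p (z + d • Pi.single j 1) m ≤ v j / p j →
      showUpTail p z (m - 1) ≤ v j / p j)
    (hx : LocallyOptimal p v B N past x j) (hij : i ≠ j) (hi : x i < N i) :
    ∃ l : ℕ, l ≤ d ∧ ∃ x' : Fin k → ℕ, x' + l • Pi.single j 1 = x + Pi.single i 1 ∧
      LocallyOptimal p v B N past x' j := by
  obtain ⟨X, hX⟩ := exists_isGreatest_localArgmax p v B N past (x + Pi.single i 1) j
  have hXx : X ≤ x j := by
    by_contra! hlt
    have h1 := lt_mul_showUpTail_of_isGreatest hx.2 (hlt.trans_le hX.1.1)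
    have h2 := mul_showUpTail_le_of_isGreatest hX hlt
    rw [add_update_add_single _ _ hij] at h2
    have h3 := mul_le_mul_of_nonneg_left
      (showUpTail_le_add_single p (past + Function.update x j (x j)) i B) hp.le
    linarith
  have hxX : x j ≤ X + d := by
    by_contra! hlt
    have hN := hx.1 j
    have h1 := lt_mul_showUpTail_of_isGreatest hX (by omega)
    have h2 := mul_showUpTail_le_of_isGreatest hx.2 hlt
    rw [add_update_add_single _ _ hij] at h1
    rw [add_update_add, mul_comm, ← le_div_iff₀ hp] at h2
    have h3 := (showUpTail_add_single_le p _ i _).trans (hd _ _ h2)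
    rw [le_div_iff₀ hp, mul_comm] at h3
    linarith
  refine ⟨x j - X, by omega, Function.update (x + Pi.single i 1) j X, ?_, ?_, ?_⟩
  · ext n
    by_cases hn : n = j
    · subst hn
      simp [hij.symm]
      omega
    · simp [hn]
  · intro n
    by_cases hn : n = j
    · subst hn
      simpa using hX.1.1
    · by_cases hni : n = i
      · subst hni
        simpa [hn] using hi
      · simpa [hn, hni] using hx.1 n
  · rw [localArgmax_congr p v B N past (y := x + Pi.single i 1)
      (fun n hn => Function.update_of_ne hn _ _), Function.update_self]
    exact hX

/-- Accepting `t` more customers of type `i` one by one leads from `x` to `y`, since a locally optimal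
solution is determined by its entries other than `j`. -/
theorem LocallyOptimal.le_and_le_add_mul {p : Fin k → I} {v : Fin k → ℝ} {B : ℕ}
    {N past x y : Fin k → ℕ} {i j : Fin k} (hp : (0 : ℝ) < p j) {d : ℕ}
    (hd : ∀ (z : Fin k → ℕ) (m : ℤ), showUpTail p (z + d • Pi.single j 1) m ≤ v j / p j →
      showUpTail p z (m - 1) ≤ v j / p j)
    (hx : LocallyOptimal p v B N past x j) (hy : LocallyOptimal p v B N past y j) (hij : i ≠ j)
    (hxy : ∀ n, n ≠ i → n ≠ j → x n = y n) {t : ℕ} (ht : y i = x i + t) :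
    y j ≤ x j ∧ x j ≤ y j + d * t := by
  induction t generalizing x with
  | zero =>
    have : x = y := hx.eq_of_eq_off hy fun n hn => by
      by_cases hni : n = i
      · subst hni
        omega
      · exact hxy n hni hn
    subst this
    simp
  | succ t ih =>
    obtain ⟨l, hl, x', hx'eq, hx'⟩ := hx.exists_add_single hp hd hij
      (show x i < N i by have := hy.1 i; omega)
    have happ : ∀ n, x' n + l * (Pi.single j 1 : Fin k → ℕ) n = x n + (Pi.single i 1 : Fin k → ℕ) n :=
      fun n => by simpa using congrFun hx'eq n
    have hj := happ j
    have hi := happ i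
    simp only [Pi.single_eq_same, Pi.single_eq_of_ne hij.symm, Pi.single_eq_of_ne hij] at hj hi
    obtain ⟨h1, h2⟩ := ih hx' (fun n hni hnj => by
      have := happ n
      simp only [Pi.single_eq_of_ne hni, Pi.single_eq_of_ne hnj] at this
      rw [← hxy n hni hnj]
      omega) (by omega)
    rw [Nat.mul_succ]
    omega

end Overbooking

theorem lemma2 {k : ℕ} (p : Fin k → I) (hp : ∀ n, (0 : ℝ) < p n)
    (v : Fin k → ℝ) (hq : ∀ n, v n / p n < 1) :
    ∃ δ : ℕ, 1 ≤ δ ∧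
      ∀ (B : ℕ) (N past : Fin k → ℕ) (i j : Fin k),
        (∀ x : Fin k → ℕ, Overbooking.LocallyOptimal p v B N past x j → (i ≠ j → x i < N i) →
          ∃ l : ℕ, l ≤ δ ∧ ∃ x' : Fin k → ℕ,
            x' + l • Pi.single j 1 = x + Pi.single i 1 ∧
            Overbooking.LocallyOptimal p v B N past x' j) ∧
        (∀ x y : Fin k → ℕ, Overbooking.LocallyOptimal p v B N past x j →
          Overbooking.LocallyOptimal p v B N past y j →
          (∀ n, n ≠ i → n ≠ j → x n = y n) →
          |(x j : ℤ) - (y j : ℤ)| ≤ (δ : ℤ) * |(x i : ℤ) - (y i : ℤ)|) := by 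
  choose d hd using fun j => Overbooking.exists_showUpTail_sub_one_le p (hp j) (hq j)
  have hle : ∀ j, d j ≤ 1 + ∑ n, d n := fun j =>
    (Finset.single_le_sum (f := d) (fun _ _ => Nat.zero_le _) (Finset.mem_univ j)).trans (by omega)
  refine ⟨1 + ∑ n, d n, by omega, fun B N past i j => ⟨fun x hx hi => ?_, fun x y hx hy hxy => ?_⟩⟩
  · by_cases hij : i = j
    · subst hij
      exact ⟨1, by omega, x, by rw [one_nsmul], hx⟩
    · obtain ⟨l, hl, h⟩ := hx.exists_add_single (hp j) (hd j) hij (hi hij)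
      exact ⟨l, hl.trans (hle j), h⟩
  · by_cases hij : i = j
    · subst hij
      exact le_mul_of_one_le_left (abs_nonneg _) (by exact_mod_cast Nat.le_add_right 1 _)
    · have key : ∀ x y : Fin k → ℕ, Overbooking.LocallyOptimal p v B N past x j →
          Overbooking.LocallyOptimal p v B N past y j → (∀ n, n ≠ i → n ≠ j → x n = y n) →
          x i ≤ y i → |(x j : ℤ) - (y j : ℤ)| ≤
            ((1 + ∑ n, d n : ℕ) : ℤ) * |(x i : ℤ) - (y i : ℤ)| := by
        intro x y hx hy hxy hi
        obtain ⟨t, ht⟩ := Nat.exists_eq_add_of_le hi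
        obtain ⟨h1, h2⟩ := hx.le_and_le_add_mul (hp j) (hd j) hy hij hxy ht
        have h3 : x j ≤ y j + (1 + ∑ n, d n) * t :=
          h2.trans (Nat.add_le_add_left (Nat.mul_le_mul_right t (hle j)) _)
        have e1 : |(x j : ℤ) - (y j : ℤ)| = x j - y j := abs_of_nonneg (by omega)
        have e2 : |(x i : ℤ) - (y i : ℤ)| = t := by
          rw [ht, abs_sub_comm, abs_of_nonneg (by omega)]
          push_cast
          ring
        rw [e1, e2, sub_le_iff_le_add']
        exact_mod_cast h3
      rcases le_total (x i) (y i) with h | h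
      · exact key x y hx hy hxy h
      · rw [abs_sub_comm, abs_sub_comm (x i : ℤ)]
        exact key y x hy hx (fun n h1 h2 => (hxy n h1 h2).symm) h
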